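/- Let $\mathcal H$ be a Hilbert space over $\mathbb K=\mathbb R$ or $\mathbb C$, and let $\mathcal F=\{f_n\}_{n\in\mathbb N}$ be a frame for $\mathcal H$, i.e. there are $A,B>0$ with $A\|f\|^2\le\sum_{n}|\langle f,f_n\rangle|^2\le B\|f\|^2$ for all $f\in\mathcal H$ (so $\mathcal H$ is necessarily separable). Let $\{e_n\}_{n\in\mathbb N}$ be the canonical orthonormal basis of $\ell^2=\ell^2(\mathbb N)$, let $T:\ell^2\to\mathcal H$ be the synthesis operator of $\mathcal F$ (the bounded operator with $Te_n=f_n$ for all $n$), and let $\mathcal N=N(T)$ be its nullspace. For $I\subseteq\mathbb N$ put $\mathcal F_I=\{f_n\}_{n\in I}$, let $\mathcal M_I=\overline{\mathrm{span}}\{e_n:n\in I\}$, and let $P_I$ be the orthogonal projection of $\ell^2$ onto $\mathcal M_I$. The family $\mathcal F_I$ is a frame sequence with bounds $A,B>0$ if $A\|f\|^2\le\sum_{n\in I}|\langle f,f_n\rangle|^2\le B\|f\|^2$ for all $f\in\overline{\mathrm{span}}\,\mathcal F_I$. For closed subspaces $\mathcal M,\mathcal N'$ of a Hilbert space, the cosine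 of the (Friedrichs) angle between them is $$c[\mathcal M,\mathcal N']=\sup\{|\langle x,y\rangle| : x\in\mathcal M\cap(\mathcal M\cap\mathcal N')^\perp,\ y\in\mathcal N'\cap(\mathcal M\cap\mathcal N')^\perp,\ \|x\|=\|y\|=1\},$$ where $\sup\emptyset=0$. For a bounded operator $C$ between Hilbert spaces, its reduced minimum modulus is $\gamma(C)=\inf\{\|Cx\| : x\in N(C)^\perp,\ \|x\|=1\}\in[0,\infty]$, where $\inf\emptyset=\infty$. Then the following conditions are equivalent: 1. $\mathcal F$ is a Riesz frame: there are $A,B>0$ such that, for every $I\subseteq\mathbb N$, $\mathcal F_I$ is a frame sequence with bounds $A,B$. 2. $\mathcal N$ is compatible with the basis $\{e_n\}$: $\sup_{I\subseteq\mathbb N}c[\mathcal N,\mathcal M_I]<1$. 3. There is a uniform lower frame bound for the finite linearly independent subfamilies: there is $A>0$ such that, for every finite $J\subset\mathbb N$ for which $\mathcal F_J$ is linearly independent, $\mathcal F_J$ is a frame sequence with lower bound $A$ (and some upper bound). 4. There is $d>0$ such that $\gamma(TP_J)\ge d$ for every finite $J\subset\mathbb N$ with $\mathcal N\cap\mathcal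 M_J=\{0\}$. -/

import Mathlib

open scoped InnerProductSpace ENNReal

noncomputable section

/-- The Hilbert space `ℓ²(ℕ)` over `𝕜`. -/
abbrev EllTwo (𝕜 : Type*) [RCLike 𝕜] : Type _ := lp (fun _ : ℕ => 𝕜) 2

/-- The `n`-th vector `eₙ` of the canonical orthonormal basis of `ℓ²`. -/
def stdVec (𝕜 : Type*) [RCLike 𝕜] (n : ℕ) : EllTwo 𝕜 := lp.single 2 n (1 : 𝕜)

/-- The closed linear span of a set of vectors. -/
abbrev closedSpan (𝕜 : Type*) [RCLike 𝕜] {E : Type*} [NormedAddCommGroup E]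
    [InnerProductSpace 𝕜 E] (s : Set E) : Submodule 𝕜 E :=
  (Submodule.span 𝕜 s).topologicalClosure

/-- `M_I`: the closed span of `{eₙ : n ∈ I}` in `ℓ²`. -/
abbrev coordSubspace (𝕜 : Type*) [RCLike 𝕜] (I : Set ℕ) : Submodule 𝕜 (EllTwo 𝕜) :=
  closedSpan 𝕜 (stdVec 𝕜 '' I)

/-- `P_I`: the orthogonal projection of `ℓ²` onto `M_I`, as an operator on `ℓ²`. -/
def coordProj (𝕜 : Type*) [RCLike 𝕜] (I : Set ℕ) : EllTwo 𝕜 →L[𝕜] EllTwo 𝕜 :=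
  (coordSubspace 𝕜 I).starProjection

/-- The cosine of the (Friedrichs) angle between two closed subspaces: the supremum of
`|⟪x, y⟫|` over unit vectors `x ∈ M ⊖ (M ∩ N)` and `y ∈ N ⊖ (M ∩ N)`. All these numbers lie in
`[0, 1]`; if there are none of them the value is `0` (the angle is `π / 2`). -/
def cosAngle {𝕜 : Type*} [RCLike 𝕜] {E : Type*} [NormedAddCommGroup E]
    [InnerProductSpace 𝕜 E] (M N : Submodule 𝕜 E) : ℝ :=
  sSup {r : ℝ | ∃ x ∈ M ⊓ (M ⊓ N)ᗮ, ∃ y ∈ N ⊓ (M ⊓ N)ᗮ,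
    ‖x‖ = 1 ∧ ‖y‖ = 1 ∧ r = ‖⟪x, y⟫_𝕜‖}

/-- A closed subspace `N` of `ℓ²` is compatible with the canonical basis if the supremum, over all
`I ⊆ ℕ`, of the cosine of the angle between `N` and `M_I` is `< 1`. -/
def IsBasisCompatible {𝕜 : Type*} [RCLike 𝕜] (N : Submodule 𝕜 (EllTwo 𝕜)) : Prop :=
  (⨆ I : Set ℕ, cosAngle N (coordSubspace 𝕜 I)) < 1

/-- The reduced minimum modulus `γ(A) = inf {‖A x‖ : ‖x‖ = 1, x ∈ N(A)ᗮ}`, with values in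
`[0, ∞]`; the infimum of the empty set is `∞`, i.e. `γ(0) = ∞`. -/
def reducedMinModulus {𝕜 : Type*} [RCLike 𝕜] {E F : Type*} [NormedAddCommGroup E]
    [InnerProductSpace 𝕜 E] [NormedAddCommGroup F] [InnerProductSpace 𝕜 F]
    (A : E →L[𝕜] F) : ℝ≥0∞ :=
  ⨅ (x : E) (_ : x ∈ (LinearMap.ker (A : E →ₗ[𝕜] F))ᗮ) (_ : ‖x‖ = 1), ENNReal.ofReal ‖A x‖

section Frames

variable {𝕜 : Type*} [RCLike 𝕜] {H : Type*} [NormedAddCommGroup H] [InnerProductSpace 𝕜 H]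

/-- The frame inequalities with constants `A`, `B` for the family `f`, for all `x` in `W`. -/
def FrameInequalities {ι : Type*} (f : ι → H) (W : Submodule 𝕜 H) (A B : ℝ) : Prop :=
  ∀ x ∈ W, Summable (fun i => ‖⟪f i, x⟫_𝕜‖ ^ 2) ∧
    A * ‖x‖ ^ 2 ≤ ∑' i, ‖⟪f i, x⟫_𝕜‖ ^ 2 ∧ ∑' i, ‖⟪f i, x⟫_𝕜‖ ^ 2 ≤ B * ‖x‖ ^ 2

variable (𝕜) in
/-- `f` is a frame for `H`. -/
def IsFrame (f : ℕ → H) : Prop :=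
  ∃ A B : ℝ, 0 < A ∧ 0 < B ∧ FrameInequalities f (⊤ : Submodule 𝕜 H) A B

variable (𝕜) in
/-- The subfamily `(fₙ)_{n ∈ I}` is a frame sequence (a frame for its closed span) with
(not necessarily optimal) bounds `A`, `B`. -/
def IsFrameSeqWithBounds (f : ℕ → H) (I : Set ℕ) (A B : ℝ) : Prop :=
  0 < A ∧ 0 < B ∧ FrameInequalities (fun n : I => f n) (closedSpan 𝕜 (f '' I)) A B

variable (𝕜) in
/-- A Riesz frame: a frame all of whose subfamilies are frame sequences with common bounds. -/
def IsRieszFrame (f : ℕ → H) : Prop :=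
  IsFrame 𝕜 f ∧ ∃ A B : ℝ, 0 < A ∧ 0 < B ∧ ∀ I : Set ℕ, IsFrameSeqWithBounds 𝕜 f I A B

theorem IsFrame.memℓp {f : ℕ → H} (hf : IsFrame 𝕜 f) (x : H) :
    Memℓp (fun n => ⟪f n, x⟫_𝕜) 2 := by
  obtain ⟨A, B, -, -, h⟩ := hf
  refine memℓp_gen ?_
  simpa using (h x trivial).1

/-- The analysis operator `x ↦ (⟨x, fₙ⟩)ₙ` of a frame. -/
def IsFrame.analysis {f : ℕ → H} (hf : IsFrame 𝕜 f) : H →L[𝕜] EllTwo 𝕜 :=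
  LinearMap.mkContinuousOfExistsBound
    { toFun := fun x => ⟨fun n => ⟪f n, x⟫_𝕜, hf.memℓp x⟩
      map_add' := fun x y => by
        ext n
        exact inner_add_right _ _ _
      map_smul' := fun c x => by
        ext n
        exact inner_smul_right _ _ _ } (by
    obtain ⟨A, B, -, hB, h⟩ := id hf
    refine ⟨Real.sqrt B, fun x => ?_⟩
    have h2 := (h x trivial).2.2
    have h0 : 0 < (2 : ℝ≥0∞).toReal := by norm_num
    refine lp.norm_le_of_tsum_le h0 (by positivity) ?_
    simpa [mul_pow, Real.sq_sqrt hB.le] using h2)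

/-- The synthesis operator `T : ℓ² → H` of a frame, i.e. the adjoint of the analysis operator;
it is the unique bounded operator with `T eₙ = fₙ` for all `n`, see `IsFrame.synthesis_stdVec` and
`IsFrame.eq_synthesis`. -/
def IsFrame.synthesis [CompleteSpace H] {f : ℕ → H} (hf : IsFrame 𝕜 f) : EllTwo 𝕜 →L[𝕜] H :=
  ContinuousLinearMap.adjoint hf.analysis

theorem IsFrame.synthesis_stdVec [CompleteSpace H] {f : ℕ → H} (hf : IsFrame 𝕜 f) (n : ℕ) :
    hf.synthesis (stdVec 𝕜 n) = f n := by
  refine ext_inner_right 𝕜 fun x => ?_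
  rw [IsFrame.synthesis, ContinuousLinearMap.adjoint_inner_left, stdVec, lp.inner_single_left]
  change ⟪(1 : 𝕜), ⟪f n, x⟫_𝕜⟫_𝕜 = _
  simp

theorem IsFrame.eq_synthesis [CompleteSpace H] {f : ℕ → H} (hf : IsFrame 𝕜 f)
    (T : EllTwo 𝕜 →L[𝕜] H) (hT : ∀ n, T (stdVec 𝕜 n) = f n) : T = hf.synthesis := by
  refine lp.ext_continuousLinearMap (by norm_num) fun n => ?_
  ext
  exact (hT n).trans (hf.synthesis_stdVec n).symm

end Frames

end

/-! Write `T` for the synthesis operator, `N` for its kernel, `P_I` for the coordinate projection.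
All four conditions say that the operators `T P_I` are bounded below off their kernels, uniformly in
`I`. Frames: the analysis operator of `F_I` is essentially `(T P_I)*`, and an operator and its
adjoint have the same lower bounds off their kernels (`boundedBelowOffKer_adjoint_iff`). So a lower
frame bound `A` matches the constant `√A`. Angles: for `y` in `M_I ⊖ (N ∩ M_I)`, which is `ker(T
P_I)ᗮ`, the size of `T y` is comparable to the distance from `y` to `N`, and the angle controls that
distance (`BoundedBelowOffKer.comp_starProjection`, `BoundedBelowOffKer.cosAngle_le`). Finite to
infinite: a vector of `span F_I` lies in the span of a finite independent subfamily; its lower bound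
passes to `F_I` because adding indices only increases the sum, and then to the closed span by
density (`IsFrame.boundedBelowOffKer_of_finset`). -/

section BoundedBelow

variable {𝕜 : Type*} [RCLike 𝕜] {E F : Type*} [NormedAddCommGroup E] [InnerProductSpace 𝕜 E]
  [NormedAddCommGroup F] [InnerProductSpace 𝕜 F]

/-- `S` is bounded below by `c` on the orthogonal complement of its kernel. -/
def BoundedBelowOffKer (S : E →L[𝕜] F) (c : ℝ) : Prop :=
  ∀ x ∈ (LinearMap.ker (S : E →ₗ[𝕜] F))ᗮ, c * ‖x‖ ≤ ‖S x‖

theorem ofReal_le_reducedMinModulus_iff (S : E →L[𝕜] F) {c : ℝ} :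
    ENNReal.ofReal c ≤ reducedMinModulus S ↔ BoundedBelowOffKer S c := by
  unfold reducedMinModulus BoundedBelowOffKer
  simp only [le_iInf_iff]
  constructor
  · intro h x hx
    rcases eq_or_ne x 0 with rfl | hx0
    · simp
    have hn : ‖x‖ ≠ 0 := norm_ne_zero_iff.2 hx0
    have h1 := h (((‖x‖⁻¹ : ℝ) : 𝕜) • x) (Submodule.smul_mem _ _ hx) (by
      rw [norm_smul, RCLike.norm_ofReal, abs_of_nonneg (by positivity), inv_mul_cancel₀ hn])
    rw [ENNReal.ofReal_le_ofReal_iff (norm_nonneg _), map_smul, norm_smul, RCLike.norm_ofReal,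
      abs_of_nonneg (by positivity)] at h1
    rwa [← le_div_iff₀ (by positivity), div_eq_inv_mul]
  · intro h x hx hx1
    simpa [hx1] using ENNReal.ofReal_le_ofReal (h x hx)

/-- The kernel of `T P_M` is the orthogonal sum of `Mᗮ` and `ker T ⊓ M`. The complement is the very
subspace of `M` that enters `cosAngle (ker T) M`. -/
theorem orthogonal_ker_comp_starProjection (T : E →L[𝕜] F) (M : Submodule 𝕜 E)
    [M.HasOrthogonalProjection] :
    (LinearMap.ker ((T ∘L M.starProjection : E →L[𝕜] F) : E →ₗ[𝕜] F))ᗮ =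
      M ⊓ (LinearMap.ker (T : E →ₗ[𝕜] F) ⊓ M)ᗮ := by
  apply le_antisymm
  · intro x hx
    rw [Submodule.mem_orthogonal] at hx
    constructor
    · suffices x ∈ Mᗮᗮ by rwa [M.orthogonal_orthogonal] at this
      rw [Submodule.mem_orthogonal]
      intro u hu
      refine hx u ?_
      simp [(Submodule.starProjection_apply_eq_zero_iff M).2 hu]
    · rw [SetLike.mem_coe, Submodule.mem_orthogonal]
      rintro u ⟨hu, huM⟩
      refine hx u ?_
      have : T u = 0 := hu
      simp [Submodule.starProjection_eq_self_iff.2 huM, this]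
  · rintro x ⟨hxM, hx⟩
    rw [SetLike.mem_coe, Submodule.mem_orthogonal] at hx
    rw [Submodule.mem_orthogonal]
    intro u hu
    have hPx : M.starProjection x = x := Submodule.starProjection_eq_self_iff.2 hxM
    rw [← hPx, ← Submodule.inner_starProjection_left_eq_right]
    exact hx _ ⟨hu, M.starProjection_apply_mem u⟩

/-! ### Angles and lower bounds for compressions -/

theorem norm_inner_le_one_of_mem_cosAngle (M N : Submodule 𝕜 E) :
    ∀ r ∈ {r : ℝ | ∃ x ∈ M ⊓ (M ⊓ N)ᗮ, ∃ y ∈ N ⊓ (M ⊓ N)ᗮ,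
      ‖x‖ = 1 ∧ ‖y‖ = 1 ∧ r = ‖⟪x, y⟫_𝕜‖}, r ≤ 1 := by
  rintro r ⟨x, -, y, -, hx, hy, rfl⟩
  simpa [hx, hy] using norm_inner_le_norm (𝕜 := 𝕜) x y

theorem cosAngle_nonneg (M N : Submodule 𝕜 E) : 0 ≤ cosAngle M N := by
  refine Real.sSup_nonneg ?_
  rintro r ⟨x, -, y, -, -, -, rfl⟩
  exact norm_nonneg _

theorem cosAngle_le_one (M N : Submodule 𝕜 E) : cosAngle M N ≤ 1 :=
  Real.sSup_le (norm_inner_le_one_of_mem_cosAngle M N) zero_le_one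

theorem norm_inner_le_cosAngle {M N : Submodule 𝕜 E} {x y : E} (hx : x ∈ M ⊓ (M ⊓ N)ᗮ)
    (hy : y ∈ N ⊓ (M ⊓ N)ᗮ) : ‖⟪x, y⟫_𝕜‖ ≤ cosAngle M N * ‖x‖ * ‖y‖ := by
  rcases eq_or_ne x 0 with rfl | hx0
  · simp
  rcases eq_or_ne y 0 with rfl | hy0
  · simp
  have hnx : ‖x‖ ≠ 0 := norm_ne_zero_iff.2 hx0
  have hny : ‖y‖ ≠ 0 := norm_ne_zero_iff.2 hy0
  have key : ‖⟪((‖x‖⁻¹ : ℝ) : 𝕜) • x, ((‖y‖⁻¹ : ℝ) : 𝕜) • y⟫_𝕜‖ ≤ cosAngle M N := by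
    refine le_csSup ⟨1, norm_inner_le_one_of_mem_cosAngle M N⟩
      ⟨_, Submodule.smul_mem _ _ hx, _, Submodule.smul_mem _ _ hy, ?_, ?_, rfl⟩
    · rw [norm_smul, RCLike.norm_ofReal, abs_of_nonneg (by positivity), inv_mul_cancel₀ hnx]
    · rw [norm_smul, RCLike.norm_ofReal, abs_of_nonneg (by positivity), inv_mul_cancel₀ hny]
  rw [inner_smul_left, inner_smul_right, norm_mul, norm_mul, RCLike.norm_conj, RCLike.norm_ofReal,
    RCLike.norm_ofReal, abs_of_nonneg (by positivity), abs_of_nonneg (by positivity)] at key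
  have h2 := mul_le_mul_of_nonneg_right key (show 0 ≤ ‖x‖ * ‖y‖ by positivity)
  calc ‖⟪x, y⟫_𝕜‖ = ‖x‖⁻¹ * (‖y‖⁻¹ * ‖⟪x, y⟫_𝕜‖) * (‖x‖ * ‖y‖) := by field_simp
    _ ≤ _ := by rwa [mul_assoc (cosAngle M N)]

theorem starProjection_mem_orthogonal_inf {M N : Submodule 𝕜 E} [N.HasOrthogonalProjection]
    {y : E} (hy : y ∈ (N ⊓ M)ᗮ) : N.starProjection y ∈ N ⊓ (N ⊓ M)ᗮ := by
  refine ⟨N.starProjection_apply_mem y, ?_⟩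
  rw [SetLike.mem_coe, Submodule.mem_orthogonal] at *
  intro u hu
  rw [← Submodule.inner_starProjection_left_eq_right,
    Submodule.starProjection_eq_self_iff.2 hu.1]
  exact hy u hu

/-- The projection `z` of `y` is itself a competitor in the angle, and `⟪z, y⟫ = ‖z‖ ^ 2`. -/
theorem norm_starProjection_le_cosAngle {M N : Submodule 𝕜 E} [N.HasOrthogonalProjection]
    {y : E} (hy : y ∈ M ⊓ (N ⊓ M)ᗮ) : ‖N.starProjection y‖ ≤ cosAngle N M * ‖y‖ := by
  have h := norm_inner_le_cosAngle (starProjection_mem_orthogonal_inf hy.2) hy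
  set z := N.starProjection y with hz
  have hzz : ⟪z, y⟫_𝕜 = ⟪z, z⟫_𝕜 := by
    have h1 : N.starProjection z = z :=
      Submodule.starProjection_eq_self_iff.2 (N.starProjection_apply_mem y)
    conv_lhs => rw [← h1, Submodule.inner_starProjection_left_eq_right]
  have h2 : ‖⟪z, z⟫_𝕜‖ = ‖z‖ * ‖z‖ := by rw [inner_self_eq_norm_sq_to_K]; simp [sq]
  rw [hzz, h2] at h
  rcases (norm_nonneg z).eq_or_lt with h0 | h0
  · rw [← h0]
    exact mul_nonneg (cosAngle_nonneg _ _) (norm_nonneg _)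
  · exact le_of_mul_le_mul_right (by linarith) h0

theorem norm_sq_sub_starProjection (N : Submodule 𝕜 E) [N.HasOrthogonalProjection] (y : E) :
    ‖y‖ ^ 2 = ‖N.starProjection y‖ ^ 2 + ‖y - N.starProjection y‖ ^ 2 := by
  rw [N.norm_sq_eq_add_norm_sq_starProjection y, N.starProjection_orthogonal_val]

theorem map_sub_starProjection_ker (T : E →L[𝕜] F)
    [(LinearMap.ker (T : E →ₗ[𝕜] F)).HasOrthogonalProjection] (y : E) :
    T (y - (LinearMap.ker (T : E →ₗ[𝕜] F)).starProjection y) = T y := by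
  have : T ((LinearMap.ker (T : E →ₗ[𝕜] F)).starProjection y) = 0 :=
    (LinearMap.ker (T : E →ₗ[𝕜] F)).starProjection_apply_mem y
  rw [map_sub, this, sub_zero]

variable [CompleteSpace E]

/-- `T` sees only the component of `y` orthogonal to `ker T`; by Pythagoras its norm is at least
`√(1 - s ^ 2) * ‖y‖`. -/
theorem BoundedBelowOffKer.comp_starProjection {T : E →L[𝕜] F} {M : Submodule 𝕜 E}
    [M.HasOrthogonalProjection] {c s : ℝ} (hc : 0 ≤ c) (hT : BoundedBelowOffKer T c)
    (hs : cosAngle (LinearMap.ker (T : E →ₗ[𝕜] F)) M ≤ s) :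
    BoundedBelowOffKer (T ∘L M.starProjection) (c * √(1 - s ^ 2)) := by
  have : CompleteSpace (LinearMap.ker (T : E →ₗ[𝕜] F)) :=
    (ContinuousLinearMap.isClosed_ker T).completeSpace_coe
  intro y hy
  rw [orthogonal_ker_comp_starProjection] at hy
  set N := LinearMap.ker (T : E →ₗ[𝕜] F) with hN
  have h1 : ‖N.starProjection y‖ ≤ s * ‖y‖ := (norm_starProjection_le_cosAngle hy).trans
    (by gcongr)
  have h2 := norm_sq_sub_starProjection N y
  have h3 : √(1 - s ^ 2) * ‖y‖ ≤ ‖y - N.starProjection y‖ := by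
    rw [← Real.sqrt_sq (norm_nonneg y), ← Real.sqrt_mul' _ (sq_nonneg _)]
    refine Real.sqrt_le_iff.2 ⟨norm_nonneg _, ?_⟩
    have h5 : ‖N.starProjection y‖ ^ 2 ≤ (s * ‖y‖) ^ 2 := by gcongr
    linarith
  have h4 := hT _ (N.sub_starProjection_mem_orthogonal y)
  rw [map_sub_starProjection_ker] at h4
  rw [ContinuousLinearMap.comp_apply, Submodule.starProjection_eq_self_iff.2 hy.1]
  calc _ = c * (√(1 - s ^ 2) * ‖y‖) := by ring
    _ ≤ c * ‖y - N.starProjection y‖ := by gcongr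
    _ ≤ _ := h4

/-- Conversely, a unit vector `y` with `c ≤ ‖T y‖` is at distance at least `c / K` from `ker T`,
which limits its projection onto `ker T`. -/
theorem BoundedBelowOffKer.cosAngle_le {T : E →L[𝕜] F} {M : Submodule 𝕜 E}
    [M.HasOrthogonalProjection] {c K : ℝ} (hc : 0 ≤ c) (hK : 0 < K) (hTK : ‖T‖ ≤ K)
    (h : BoundedBelowOffKer (T ∘L M.starProjection) c) :
    cosAngle (LinearMap.ker (T : E →ₗ[𝕜] F)) M ≤ √(1 - (c / K) ^ 2) := by
  have : CompleteSpace (LinearMap.ker (T : E →ₗ[𝕜] F)) :=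
    (ContinuousLinearMap.isClosed_ker T).completeSpace_coe
  refine Real.sSup_le ?_ (Real.sqrt_nonneg _)
  rintro r ⟨x, hx, y, hy, hx1, hy1, rfl⟩
  have h1 := h y (by rwa [orthogonal_ker_comp_starProjection])
  rw [ContinuousLinearMap.comp_apply, Submodule.starProjection_eq_self_iff.2 hy.1,
    ← map_sub_starProjection_ker, hy1, mul_one] at h1
  set N := LinearMap.ker (T : E →ₗ[𝕜] F) with hN
  have h2 := norm_sq_sub_starProjection N y
  have h3 : c / K ≤ ‖y - N.starProjection y‖ := by
    rw [div_le_iff₀' hK]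
    exact h1.trans (T.le_of_opNorm_le hTK _)
  have h4 : ‖⟪x, y⟫_𝕜‖ ≤ ‖N.starProjection y‖ := by
    have hNx : N.starProjection x = x := Submodule.starProjection_eq_self_iff.2 hx.1
    rw [← hNx, Submodule.inner_starProjection_left_eq_right]
    simpa [hx1] using norm_inner_le_norm (𝕜 := 𝕜) x (N.starProjection y)
  refine h4.trans (Real.le_sqrt_of_sq_le ?_)
  have h5 : (c / K) ^ 2 ≤ ‖y - N.starProjection y‖ ^ 2 := by gcongr
  rw [hy1] at h2
  linarith

/-! ### Lower bounds of adjoints -/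

variable [CompleteSpace F]

theorem BoundedBelowOffKer.adjoint {S : E →L[𝕜] F} {c : ℝ} (hS : BoundedBelowOffKer S c) :
    BoundedBelowOffKer (ContinuousLinearMap.adjoint S) c := by
  intro y hy
  have hy' : y ∈ closure (Set.range S) := by
    have := ContinuousLinearMap.orthogonal_ker (ContinuousLinearMap.adjoint S)
    rw [ContinuousLinearMap.adjoint_adjoint] at this
    rw [this] at hy
    exact hy
  -- The inequality is a closed condition, so it suffices to check it on the range of `S`.
  refine closure_minimal (t := {y | c * ‖y‖ ≤ ‖ContinuousLinearMap.adjoint S y‖}) ?_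
    (isClosed_le (by fun_prop) (by fun_prop)) hy'
  rintro _ ⟨x, rfl⟩
  have : CompleteSpace (LinearMap.ker (S : E →ₗ[𝕜] F)) :=
    (ContinuousLinearMap.isClosed_ker S).completeSpace_coe
  set K := LinearMap.ker (S : E →ₗ[𝕜] F)
  set z := x - K.starProjection x with hz
  have hzK : z ∈ Kᗮ := K.sub_starProjection_mem_orthogonal x
  have hSz : S z = S x := by
    have : S (K.starProjection x) = 0 := K.starProjection_apply_mem x
    rw [hz, map_sub, this, sub_zero]
  rw [Set.mem_ofPred_eq, ← hSz]
  have h1 := hS z hzK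
  have h2 : ‖S z‖ ^ 2 ≤ ‖ContinuousLinearMap.adjoint S (S z)‖ * ‖z‖ := by
    calc ‖S z‖ ^ 2 = ‖⟪S z, S z⟫_𝕜‖ := by rw [inner_self_eq_norm_sq_to_K]; simp
      _ = ‖⟪ContinuousLinearMap.adjoint S (S z), z⟫_𝕜‖ := by
        rw [ContinuousLinearMap.adjoint_inner_left]
      _ ≤ _ := norm_inner_le_norm _ _
  rcases (norm_nonneg z).eq_or_lt with h0 | h0
  · rw [eq_comm, norm_eq_zero] at h0
    simp [h0]
  · nlinarith [norm_nonneg (S z)]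

theorem boundedBelowOffKer_adjoint_iff {S : E →L[𝕜] F} {c : ℝ} :
    BoundedBelowOffKer (ContinuousLinearMap.adjoint S) c ↔ BoundedBelowOffKer S c :=
  ⟨fun h => by simpa using h.adjoint, fun h => h.adjoint⟩

end BoundedBelow

/-! ### Coordinate projections and subfamilies of a frame -/

section Frames

variable {𝕜 : Type*} [RCLike 𝕜]

theorem stdVec_mem_coordSubspace {I : Set ℕ} {n : ℕ} (hn : n ∈ I) :
    stdVec 𝕜 n ∈ coordSubspace 𝕜 I :=
  Submodule.le_topologicalClosure _ (Submodule.subset_span ⟨n, hn, rfl⟩)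

theorem inner_stdVec (n : ℕ) (x : EllTwo 𝕜) : ⟪stdVec 𝕜 n, x⟫_𝕜 = x n := by
  rw [stdVec, lp.inner_single_left]
  simp

theorem stdVec_mem_coordSubspace_orthogonal {I : Set ℕ} {n : ℕ} (hn : n ∉ I) :
    stdVec 𝕜 n ∈ (coordSubspace 𝕜 I)ᗮ := by
  rw [Submodule.orthogonal_closure, Submodule.mem_orthogonal]
  intro u hu
  induction hu using Submodule.span_induction with
  | mem x hx =>
    obtain ⟨m, hm, rfl⟩ := hx
    rw [inner_stdVec, stdVec, lp.single_apply_ne]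
    rintro rfl
    exact hn hm
  | zero => simp
  | add x y _ _ hx hy => rw [inner_add_left, hx, hy, add_zero]
  | smul a x _ hx => rw [inner_smul_left, hx, mul_zero]

open Classical in
theorem coordProj_apply (I : Set ℕ) (x : EllTwo 𝕜) (n : ℕ) :
    coordProj 𝕜 I x n = if n ∈ I then x n else 0 := by
  have h1 : coordProj 𝕜 I x n = ⟪coordProj 𝕜 I (stdVec 𝕜 n), x⟫_𝕜 := by
    rw [← inner_stdVec]
    exact (Submodule.inner_starProjection_left_eq_right _ _ _).symm
  rw [h1]
  split_ifs with h
  · have : coordProj 𝕜 I (stdVec 𝕜 n) = stdVec 𝕜 n :=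
      Submodule.starProjection_eq_self_iff.2 (stdVec_mem_coordSubspace h)
    rw [this, inner_stdVec]
  · have : coordProj 𝕜 I (stdVec 𝕜 n) = 0 :=
      (Submodule.starProjection_apply_eq_zero_iff _).2 (stdVec_mem_coordSubspace_orthogonal h)
    rw [this, inner_zero_left]

theorem EllTwo.hasSum_norm_sq (x : EllTwo 𝕜) : HasSum (fun n => ‖x n‖ ^ 2) (‖x‖ ^ 2) := by
  simpa using lp.hasSum_norm (p := 2) (by norm_num) x

theorem hasSum_norm_sq_coordProj (I : Set ℕ) (x : EllTwo 𝕜) :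
    HasSum (fun n : I => ‖x n‖ ^ 2) (‖coordProj 𝕜 I x‖ ^ 2) := by
  rw [show (fun n : I => ‖x n‖ ^ 2) = (fun n => ‖x n‖ ^ 2) ∘ ((↑) : I → ℕ) from rfl,
    hasSum_subtype_iff_indicator]
  convert! EllTwo.hasSum_norm_sq (coordProj 𝕜 I x) using 2 with n
  rw [coordProj_apply]
  by_cases h : n ∈ I <;> simp [h]

variable {H : Type*} [NormedAddCommGroup H] [InnerProductSpace 𝕜 H] [CompleteSpace H] {f : ℕ → H}

theorem IsFrame.adjoint_synthesis_comp_coordProj (hf : IsFrame 𝕜 f) (I : Set ℕ) (h : H) :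
    ContinuousLinearMap.adjoint (hf.synthesis ∘L coordProj 𝕜 I) h =
      coordProj 𝕜 I (hf.analysis h) := by
  have h1 : ContinuousLinearMap.adjoint (coordProj 𝕜 I) = coordProj 𝕜 I :=
    isSelfAdjoint_starProjection _
  rw [ContinuousLinearMap.adjoint_comp, h1, IsFrame.synthesis,
    ContinuousLinearMap.adjoint_adjoint, ContinuousLinearMap.comp_apply]

theorem IsFrame.hasSum_norm_sq (hf : IsFrame 𝕜 f) (I : Set ℕ) (h : H) :
    HasSum (fun n : I => ‖⟪f n, h⟫_𝕜‖ ^ 2)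
      (‖ContinuousLinearMap.adjoint (hf.synthesis ∘L coordProj 𝕜 I) h‖ ^ 2) := by
  rw [hf.adjoint_synthesis_comp_coordProj]
  exact hasSum_norm_sq_coordProj I (hf.analysis h)

theorem IsFrame.norm_adjoint_mono (hf : IsFrame 𝕜 f) {I J : Set ℕ} (hIJ : I ⊆ J) (h : H) :
    ‖ContinuousLinearMap.adjoint (hf.synthesis ∘L coordProj 𝕜 I) h‖ ≤
      ‖ContinuousLinearMap.adjoint (hf.synthesis ∘L coordProj 𝕜 J) h‖ := by
  refine (sq_le_sq₀ (norm_nonneg _) (norm_nonneg _)).1 ?_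
  have hI := hf.hasSum_norm_sq I h
  have hJ := hf.hasSum_norm_sq J h
  generalize ‖ContinuousLinearMap.adjoint (hf.synthesis ∘L coordProj 𝕜 I) h‖ ^ 2 = a at hI ⊢
  generalize ‖ContinuousLinearMap.adjoint (hf.synthesis ∘L coordProj 𝕜 J) h‖ ^ 2 = b at hJ ⊢
  refine hasSum_le_inj (Set.inclusion hIJ) (Set.inclusion_injective hIJ) (fun n _ => ?_)
    (fun n => ?_) hI hJ
  · positivity
  · rfl

theorem IsFrame.closure_range_synthesis_comp_coordProj (hf : IsFrame 𝕜 f) (I : Set ℕ) :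
    (LinearMap.range ((hf.synthesis ∘L coordProj 𝕜 I : EllTwo 𝕜 →L[𝕜] H) :
      EllTwo 𝕜 →ₗ[𝕜] H)).topologicalClosure = closedSpan 𝕜 (f '' I) := by
  apply le_antisymm
  · refine Submodule.topologicalClosure_minimal _ ?_ (Submodule.isClosed_topologicalClosure _)
    rintro _ ⟨x, rfl⟩
    have hx : coordProj 𝕜 I x ∈ coordSubspace 𝕜 I := Submodule.starProjection_apply_mem _ x
    have hle : coordSubspace 𝕜 I ≤
        (closedSpan 𝕜 (f '' I)).comap (hf.synthesis : EllTwo 𝕜 →ₗ[𝕜] H) := by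
      refine Submodule.topologicalClosure_minimal _ (Submodule.span_le.2 ?_)
        ((Submodule.isClosed_topologicalClosure _).preimage hf.synthesis.continuous)
      rintro _ ⟨n, hn, rfl⟩
      change hf.synthesis (stdVec 𝕜 n) ∈ closedSpan 𝕜 (f '' I)
      rw [hf.synthesis_stdVec]
      exact Submodule.le_topologicalClosure _ (Submodule.subset_span (Set.mem_image_of_mem f hn))
    exact hle hx
  · refine Submodule.topologicalClosure_mono (Submodule.span_le.2 ?_)
    rintro _ ⟨n, hn, rfl⟩
    refine ⟨stdVec 𝕜 n, ?_⟩
    have : coordProj 𝕜 I (stdVec 𝕜 n) = stdVec 𝕜 n :=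
      Submodule.starProjection_eq_self_iff.2 (stdVec_mem_coordSubspace hn)
    simp [this, hf.synthesis_stdVec]

/-- The closed span of `F_I` is the closure of the range of `T P_I`, hence the complement of the
kernel of its adjoint. -/
theorem IsFrame.boundedBelowOffKer_iff (hf : IsFrame 𝕜 f) (I : Set ℕ) {c : ℝ} :
    BoundedBelowOffKer (hf.synthesis ∘L coordProj 𝕜 I) c ↔ ∀ h ∈ closedSpan 𝕜 (f '' I),
      c * ‖h‖ ≤ ‖ContinuousLinearMap.adjoint (hf.synthesis ∘L coordProj 𝕜 I) h‖ := by
  have h1 := ContinuousLinearMap.orthogonal_ker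
    (ContinuousLinearMap.adjoint (hf.synthesis ∘L coordProj 𝕜 I))
  rw [ContinuousLinearMap.adjoint_adjoint] at h1
  rw [← boundedBelowOffKer_adjoint_iff, ← hf.closure_range_synthesis_comp_coordProj I, ← h1]
  rfl

theorem IsFrameSeqWithBounds.boundedBelowOffKer (hf : IsFrame 𝕜 f) {I : Set ℕ} {A B : ℝ}
    (h : IsFrameSeqWithBounds 𝕜 f I A B) :
    BoundedBelowOffKer (hf.synthesis ∘L coordProj 𝕜 I) (√A) := by
  rw [hf.boundedBelowOffKer_iff]
  intro x hx
  have h1 := (h.2.2 x hx).2.1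
  rw [(hf.hasSum_norm_sq I x).tsum_eq] at h1
  refine (sq_le_sq₀ (by positivity) (norm_nonneg _)).1 ?_
  rwa [mul_pow, Real.sq_sqrt h.1.le]

theorem IsFrame.exists_isFrameSeqWithBounds (hf : IsFrame 𝕜 f) :
    ∃ B : ℝ, 0 < B ∧ ∀ (I : Set ℕ) (c : ℝ), 0 < c →
      BoundedBelowOffKer (hf.synthesis ∘L coordProj 𝕜 I) c →
        IsFrameSeqWithBounds 𝕜 f I (c ^ 2) B := by
  obtain ⟨A, B, -, hB, h⟩ := id hf
  refine ⟨B, hB, fun I c hc hI => ⟨by positivity, hB, fun x hx => ?_⟩⟩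
  have hs := hf.hasSum_norm_sq I x
  refine ⟨hs.summable, ?_, ?_⟩
  · rw [hs.tsum_eq, ← mul_pow]
    have := (hf.boundedBelowOffKer_iff I).1 hI x hx
    gcongr
  · have hx' := h x trivial
    exact (hx'.1.tsum_subtype_le _ I (fun _ => sq_nonneg _)).trans hx'.2.2

theorem IsFrame.exists_boundedBelowOffKer_synthesis (hf : IsFrame 𝕜 f) :
    ∃ c : ℝ, 0 < c ∧ BoundedBelowOffKer hf.synthesis c := by
  obtain ⟨A, B, hA, -, h⟩ := id hf
  refine ⟨√A, Real.sqrt_pos.2 hA, ?_⟩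
  rw [← boundedBelowOffKer_adjoint_iff, IsFrame.synthesis, ContinuousLinearMap.adjoint_adjoint]
  intro x _
  have h1 := (h x trivial).2.1
  have h2 : HasSum (fun n => ‖⟪f n, x⟫_𝕜‖ ^ 2) (‖hf.analysis x‖ ^ 2) :=
    EllTwo.hasSum_norm_sq (hf.analysis x)
  rw [h2.tsum_eq] at h1
  refine (sq_le_sq₀ (by positivity) (norm_nonneg _)).1 ?_
  rwa [mul_pow, Real.sq_sqrt hA.le]

theorem IsFrame.linearIndependent_iff (hf : IsFrame 𝕜 f) (J : Finset ℕ) :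
    LinearIndependent 𝕜 (fun n : J => f n) ↔
      LinearMap.ker (hf.synthesis : EllTwo 𝕜 →ₗ[𝕜] H) ⊓ coordSubspace 𝕜 (J : Set ℕ) = ⊥ := by
  have hfin : coordSubspace 𝕜 (J : Set ℕ) =
      Submodule.span 𝕜 (Set.range fun n : J => stdVec 𝕜 (n : ℕ)) := by
    have himg : stdVec 𝕜 '' (J : Set ℕ) = Set.range fun n : J => stdVec 𝕜 (n : ℕ) :=
      Set.image_eq_range _ _
    have : FiniteDimensional 𝕜 (Submodule.span 𝕜 (Set.range fun n : J => stdVec 𝕜 (n : ℕ))) :=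
      FiniteDimensional.span_of_finite 𝕜 (Set.finite_range _)
    rw [coordSubspace, closedSpan, himg]
    -- Finiteness of `J` makes the span already closed.
    exact (Submodule.closed_of_finiteDimensional _).submodule_topologicalClosure_eq
  have hcomp : (fun n : J => f n) =
      (hf.synthesis : EllTwo 𝕜 →ₗ[𝕜] H) ∘ fun n : J => stdVec 𝕜 (n : ℕ) := by
    ext n
    exact (hf.synthesis_stdVec n).symm
  have hli : LinearIndependent 𝕜 (fun n : J => stdVec 𝕜 (n : ℕ)) := by
    refine Orthonormal.linearIndependent (orthonormal_iff_ite.2 fun m n => ?_)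
    rw [inner_stdVec, stdVec]
    split_ifs with h
    · rw [h, lp.single_apply_self]
    · exact lp.single_apply_ne _ _ _ fun h' => h (Subtype.ext h')
  rw [hfin, hcomp, ← disjoint_iff, disjoint_comm]
  refine ⟨fun h => Submodule.range_ker_disjoint h, fun h => ?_⟩
  rwa [LinearMap.linearIndependent_iff_of_disjoint _ h]

theorem IsFrame.boundedBelowOffKer_of_finset (hf : IsFrame 𝕜 f) {c : ℝ}
    (h : ∀ J : Finset ℕ, LinearIndependent 𝕜 (fun n : J => f n) →
      BoundedBelowOffKer (hf.synthesis ∘L coordProj 𝕜 (J : Set ℕ)) c) (I : Set ℕ) :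
    BoundedBelowOffKer (hf.synthesis ∘L coordProj 𝕜 I) c := by
  rw [hf.boundedBelowOffKer_iff]
  set S := ContinuousLinearMap.adjoint (hf.synthesis ∘L coordProj 𝕜 I) with hS
  suffices hspan : ∀ x ∈ Submodule.span 𝕜 (f '' I), c * ‖x‖ ≤ ‖S x‖ from fun x hx =>
    closure_minimal (t := {x | c * ‖x‖ ≤ ‖S x‖}) hspan (isClosed_le (by fun_prop) (by fun_prop)) hx
  intro x hx
  classical
  -- `b ⊆ I` indexes an independent subfamily whose span contains all of `F_I`; a finite part `s` of
  -- it suffices for `x`.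
  obtain ⟨b, hbI, -, hb, hli⟩ :=
    exists_linearIndepOn_extension (linearIndepOn_empty 𝕜 f) (Set.empty_subset I)
  obtain ⟨t, htb, hxt⟩ :=
    Submodule.mem_span_finite_of_mem_span (Submodule.span_le.2 hb hx)
  obtain ⟨s, hsb, rfl⟩ := Finset.subset_set_image_iff.1 htb
  rw [Finset.coe_image] at hxt
  have hs1 : LinearIndependent 𝕜 (fun n : s => f n) := hli.mono hsb
  have h1 := (hf.boundedBelowOffKer_iff (s : Set ℕ)).1 (h s hs1) x
    (Submodule.le_topologicalClosure _ hxt)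
  exact h1.trans (hf.norm_adjoint_mono (hsb.trans hbI) x)

end Frames

/-! ### The equivalences -/

theorem mainTheorem1 {𝕜 : Type*} [RCLike 𝕜] {H : Type*} [NormedAddCommGroup H]
    [InnerProductSpace 𝕜 H] [CompleteSpace H] (f : ℕ → H) (hf : IsFrame 𝕜 f) :
    List.TFAE [
      IsRieszFrame 𝕜 f,
      IsBasisCompatible (LinearMap.ker (hf.synthesis : EllTwo 𝕜 →ₗ[𝕜] H)),
      ∃ A : ℝ, 0 < A ∧ ∀ J : Finset ℕ, LinearIndependent 𝕜 (fun n : J => f n) →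
        ∃ B : ℝ, IsFrameSeqWithBounds 𝕜 f (J : Set ℕ) A B,
      ∃ d : ℝ, 0 < d ∧ ∀ J : Finset ℕ,
        LinearMap.ker (hf.synthesis : EllTwo 𝕜 →ₗ[𝕜] H) ⊓ coordSubspace 𝕜 (J : Set ℕ) = ⊥ →
          ENNReal.ofReal d ≤ reducedMinModulus (hf.synthesis ∘L coordProj 𝕜 (J : Set ℕ))] := by
  obtain ⟨B, hB, hseq⟩ := hf.exists_isFrameSeqWithBounds
  tfae_have 1 → 2 := by
    rintro ⟨-, A, B', hA, -, h⟩
    -- Adding `1` keeps the divisor positive when `T = 0`.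
    have hK : 0 < ‖hf.synthesis‖ + 1 := by positivity
    have hle : ⨆ I : Set ℕ, cosAngle (LinearMap.ker (hf.synthesis : EllTwo 𝕜 →ₗ[𝕜] H))
        (coordSubspace 𝕜 I) ≤ √(1 - (√A / (‖hf.synthesis‖ + 1)) ^ 2) :=
      ciSup_le fun I => BoundedBelowOffKer.cosAngle_le (Real.sqrt_nonneg A) hK (by linarith)
        ((h I).boundedBelowOffKer hf)
    refine hle.trans_lt ((Real.sqrt_lt' one_pos).2 ?_)
    have : 0 < (√A / (‖hf.synthesis‖ + 1)) ^ 2 := by positivity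
    linarith
  tfae_have 2 → 1 := by
    intro h
    obtain ⟨c, hc, hcT⟩ := hf.exists_boundedBelowOffKer_synthesis
    set s := ⨆ I : Set ℕ, cosAngle (LinearMap.ker (hf.synthesis : EllTwo 𝕜 →ₗ[𝕜] H))
      (coordSubspace 𝕜 I) with hs
    have hs0 : 0 ≤ s := Real.iSup_nonneg fun I => cosAngle_nonneg _ _
    have hs1 : s < 1 := h
    have hpos : 0 < c * √(1 - s ^ 2) := mul_pos hc (Real.sqrt_pos.2 (by nlinarith))
    refine ⟨hf, _, B, pow_pos hpos 2, hB, fun I => hseq I _ hpos ?_⟩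
    -- The upper bound `1` on all cosines ensures that the real supremum dominates each term.
    refine hcT.comp_starProjection hc.le (le_ciSup (f := fun I : Set ℕ => cosAngle
      (LinearMap.ker (hf.synthesis : EllTwo 𝕜 →ₗ[𝕜] H)) (coordSubspace 𝕜 I)) ⟨1, ?_⟩ I)
    rintro _ ⟨I, rfl⟩
    exact cosAngle_le_one _ _
  tfae_have 1 → 3 := by
    rintro ⟨-, A, B', hA, -, h⟩
    exact ⟨A, hA, fun J _ => ⟨B', h J⟩⟩
  tfae_have 3 → 4 := by
    rintro ⟨A, hA, h⟩
    refine ⟨√A, Real.sqrt_pos.2 hA, fun J hJ => ?_⟩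
    obtain ⟨B', hB'⟩ := h J ((hf.linearIndependent_iff J).2 hJ)
    exact (ofReal_le_reducedMinModulus_iff _).2 (hB'.boundedBelowOffKer hf)
  tfae_have 4 → 1 := by
    rintro ⟨d, hd, h⟩
    refine ⟨hf, d ^ 2, B, by positivity, hB, fun I => hseq I d hd ?_⟩
    exact hf.boundedBelowOffKer_of_finset (fun J hJ => (ofReal_le_reducedMinModulus_iff _).1
      (h J ((hf.linearIndependent_iff J).1 hJ))) I
  tfae_finish
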